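/- Let $Q$ be a connected, paracompact, Hausdorff smooth manifold of finite dimension, $k\ge 0$, let $\tau_Q:T^1_kQ=TQ\oplus\cdots\oplus TQ\to Q$ and $\tau_Q^*:(T^1_k)^*Q=T^*Q\oplus\cdots\oplus T^*Q\to Q$ be the Whitney sums of $k$ copies of the tangent and of the cotangent bundle, and let $(\omega_0)_A=-d(\theta_0)_A$, $(\theta_0)_A(\alpha)(\xi)=\alpha^A((\tau_Q^*)_*\xi)$, be the canonical $2$-forms on $(T^1_k)^*Q$ ($1\le A\le k$). For a smooth map $F:M\to N$ put $T^1_kF(v_1,\dots,v_k)=(F_*v_1,\dots,F_*v_k)$; for $\varphi:U\to M$ with $U\subseteq\mathbb R^k$ open let $\varphi^{(1)}(t)=(\varphi_*\partial_{t^1}|_t,\dots,\varphi_*\partial_{t^k}|_t)\in T^1_kM$ be its first prolongation. A map $\psi:U\to T^1_kQ$ is holonomic if $\psi=(\tau_Q\circ\psi)^{(1)}$. Let $L:T^1_kQ\to\mathbb R$ be a smooth Lagrangian with Legendre map $FL:T^1_kQ\to(T^1_k)^*Q$, $[FL(v)]^A(w)=\frac{d}{ds}\big|_{s=0}L(v_1,\dots,v_A+sw,\dots,v_k)$,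 and energy $E_L=C(L)-L$, where $C$ is the generator of the flow $(s,v)\mapsto e^sv$. Assume that $L$ is almost-regular: $\mathcal P=FL(T^1_kQ)$ is a closed embedded submanifold $\jmath_0:\mathcal P\hookrightarrow(T^1_k)^*Q$, the map $FL_0:T^1_kQ\to\mathcal P$ with $\jmath_0\circ FL_0=FL$ is a submersion, and the fibres of $FL$ are connected. (The hyper-regular case, where $FL$ is a diffeomorphism and $\mathcal P=(T^1_k)^*Q$, is included.) Let $\jmath_S:S\hookrightarrow T^1_kQ$ be an embedded submanifold such that $P=FL_0(S)$ is an embedded submanifold $\jmath_P:P\hookrightarrow\mathcal P$, and let $FL_S:S\to P$ be the restriction of $FL_0$. Let $K=(K_1,\dots,K_k):T^1_kQ\to T^1_k((T^1_k)^*Q)$ be a smooth $k$-vector field along $FL$ and $X_0$ a smooth $k$-vector field on $\mathcal P$ such that $$T^1_k\jmath_0\circ X_0\circ FL_0=K\quad\text{on }S,$$ and such that $K$ satisfies the field equation $\sum_A FL^*[\iota_{K_A}((\omega_0)_A\circ FL)]=dE_L$ at the points of $S$, or $X_0$ satisfies the Hamiltonian field equation $\sum_A\iota_{(X_0)_A}\jmath_0^*(\omega_0)_A=dH_0$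 at the points of $P$, where $H_0\in C^\infty(\mathcal P)$ and $H_0\circ FL_0=E_L$. The second-order condition for $K$ on a subset of $T^1_kQ$ is $T^1_k(\tau_Q^*)\circ K=\mathrm{Id}$ at its points. An integral section of $K$ on $S$, defined on an open $U\subseteq\mathbb R^k$, is $\psi=\jmath_S\circ\psi_S$ with $\psi_S:U\to S$ smooth and $T^1_k(FL)\circ\psi^{(1)}=K\circ\psi$; an integral section of $X_0$ on $P$ is $\psi_0=\jmath_P\circ\psi_P$ with $\psi_P:U\to P$ smooth and $\psi_0^{(1)}=X_0\circ\psi_0$. $K$ is integrable (on $S$) if through each $s\in S$ there passes an integral section of $K$ on $S$ defined on a neighbourhood of $0\in\mathbb R^k$, with $\psi_S(0)=s$; $X_0$ is integrable (on $P$) if the same holds for $X_0$ and the points of $P$. Then: 1. If $K$ is integrable then $X_0$ is integrable. If $K$ satisfies the second-order condition on $S$ (in particular if $K$ is a field operator for $L$), or if $FL_S:S\to P$ is a submersion, then $K$ is integrable if and only if $X_0$ is integrable. 2. If $\psi=\jmath_S\circ\psi_S$ is an integral section of $K$ on $S$, then, with $\psi_P:=FL_S\circ\psi_S$, $\psi_0=\jmath_P\circ\psi_P$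 is an integral section of $X_0$ on $P$. 3. Conversely, if $\psi_0=\jmath_P\circ\psi_P$ is an integral section of $X_0$ on $P$ and $\psi_S:U\to S$ is any smooth map with $FL_S\circ\psi_S=\psi_P$, then $\psi=\jmath_S\circ\psi_S$ is an integral section of $K$ on $S$. It is holonomic if and only if $K$ satisfies the second-order condition at the points of $\psi(U)$. 4. If $K$ is integrable, then all these lifts $\psi$ are holonomic if and only if $K$ satisfies the second-order condition on $S$. If $K$ satisfies the second-order condition on $S$, then it is a field operator for $L$ on $S$: a $k$-vector field along $FL$ satisfying on $S$ the field equation and the second-order condition. -/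

import Mathlib

open scoped Manifold ContDiff Topology Bundle

noncomputable section

namespace KSymplectic

/-! ### Bundles of velocities and covelocities, `k`-vector fields

`T¹ₖM = TM ⊕ ⋯ ⊕ TM` (`k` copies) is realised, through its identification with the 1-jets at `0` of
maps `ℝᵏ → M`, as the smooth vector bundle `Hom(ℝᵏ, TM)`: a point over `x` is a linear map
`v : ℝᵏ → T_xM`, and its `A`-th component is `v_A = v (e_A)`.  Dually `(T¹ₖ)*Q = T*Q ⊕ ⋯ ⊕ T*Q` is the
bundle `Hom(TQ, ℝᵏ)`: a point over `q` is `α : T_qQ → ℝᵏ`, with components `αᴬ = (α ·)_A ∈ T*_qQ`. -/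

section Bundles

variable (k : ℕ) {E : Type*} [NormedAddCommGroup E] [NormedSpace ℝ E]
  {H : Type*} [TopologicalSpace H] (I : ModelWithCorners ℝ E H)
  (M : Type*) [TopologicalSpace M] [ChartedSpace H M]

/-- The fibre of `T¹ₖM` over `x`. -/
abbrev VelFiber (x : M) : Type _ :=
  Bundle.Trivial M (Fin k → ℝ) x →L[ℝ] TangentSpace I x

/-- The tangent bundle of `k¹`-velocities `T¹ₖM`. -/
abbrev Vel : Type _ :=
  Bundle.TotalSpace ((Fin k → ℝ) →L[ℝ] E) (VelFiber k I M)

/-- The model with corners of the manifold `T¹ₖM`. -/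
abbrev velModel : ModelWithCorners ℝ (E × ((Fin k → ℝ) →L[ℝ] E))
    (ModelProd H ((Fin k → ℝ) →L[ℝ] E)) :=
  I.prod 𝓘(ℝ, (Fin k → ℝ) →L[ℝ] E)

/-- The fibre of `(T¹ₖ)*M` over `x`. -/
abbrev CovelFiber (x : M) : Type _ :=
  TangentSpace I x →L[ℝ] Bundle.Trivial M (Fin k → ℝ) x

/-- The bundle of `k¹`-covelocities `(T¹ₖ)*M`. -/
abbrev Covel : Type _ :=
  Bundle.TotalSpace (E →L[ℝ] (Fin k → ℝ)) (CovelFiber k I M)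

/-- The model with corners of the manifold `(T¹ₖ)*M`. -/
abbrev covelModel : ModelWithCorners ℝ (E × (E →L[ℝ] (Fin k → ℝ)))
    (ModelProd H (E →L[ℝ] (Fin k → ℝ))) :=
  I.prod 𝓘(ℝ, E →L[ℝ] (Fin k → ℝ))

end Bundles

section Velocities

variable {k : ℕ}
  {E : Type*} [NormedAddCommGroup E] [NormedSpace ℝ E]
  {H : Type*} [TopologicalSpace H] {I : ModelWithCorners ℝ E H}
  {M : Type*} [TopologicalSpace M] [ChartedSpace H M]
  {E' : Type*} [NormedAddCommGroup E'] [NormedSpace ℝ E']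
  {H' : Type*} [TopologicalSpace H'] {I' : ModelWithCorners ℝ E' H'}
  {N : Type*} [TopologicalSpace N] [ChartedSpace H' N]
  {E'' : Type*} [NormedAddCommGroup E''] [NormedSpace ℝ E'']
  {H'' : Type*} [TopologicalSpace H''] {I'' : ModelWithCorners ℝ E'' H''}
  {S : Type*} [TopologicalSpace S] [ChartedSpace H'' S]

/-- The `A`-th component `v_A ∈ T_xM` of `v = (v_1, …, v_k) ∈ (T¹ₖ)_xM`. -/
def comp {x : M} (v : VelFiber k I M x) (A : Fin k) : TangentSpace I x :=
  v (Pi.single A (1 : ℝ) : Fin k → ℝ)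

/-- The `k`-tuple `(0, …, w, …, 0)` with the vector `w` in position `A`. -/
def single (x : M) (A : Fin k) : TangentSpace I x →L[ℝ] VelFiber k I M x :=
  ContinuousLinearMap.smulRightL ℝ (Fin k → ℝ) E (ContinuousLinearMap.proj A)

variable (I I') in
/-- The induced map `T¹ₖF : T¹ₖM → T¹ₖN`, `(v_1, …, v_k) ↦ (F_* v_1, …, F_* v_k)`. -/
def mapVel (F : M → N) (v : Vel k I M) : Vel k I' N :=
  ⟨F v.proj, (mfderiv I I' F v.proj).comp v.2⟩

variable (I) in
/-- The first prolongation `φ⁽¹⁾(t) = (φ_*(∂/∂t¹|_t), …, φ_*(∂/∂tᵏ|_t))` of `φ : ℝᵏ → M`. -/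
def prolong (φ : (Fin k → ℝ) → M) (t : Fin k → ℝ) : Vel k I M :=
  ⟨φ t, (mfderiv 𝓘(ℝ, Fin k → ℝ) I φ t).comp
    (NormedSpace.fromTangentSpace (𝕜 := ℝ) t).symm.toContinuousLinearMap⟩

variable (k I I') in
/-- Families `(K_1, …, K_k)` of (not necessarily smooth) vector fields along `F : M → N`,
that is, maps `K : M → T¹ₖN` over `F`. -/
abbrev FieldAlong (F : M → N) : Type _ := ∀ x : M, VelFiber k I' N (F x)

/-- The map `M → T¹ₖN` given by a family of vector fields along `F`. -/
def FieldAlong.toMap {F : M → N} (K : FieldAlong k I' F) (x : M) : Vel k I' N :=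
  ⟨F x, K x⟩

variable (I) in
/-- `K : M → T¹ₖN` is a (smooth) `k`-vector field along `F : M → N`.  For `F = id` this is a
`k`-vector field on `M`, i.e. a smooth section of `T¹ₖM → M`. -/
def IsKVectorFieldAlong [IsManifold I' ∞ N] {F : M → N} (K : FieldAlong k I' F) : Prop :=
  ContMDiff I (velModel k I') ∞ K.toMap

variable (I I') in
/-- `ψ`, defined on the open set `U ⊆ ℝᵏ`, is an integral section of the `k`-vector field `K` along
`F : M → N`: `T¹ₖF ∘ ψ⁽¹⁾ = K ∘ ψ`. -/
def IsIntegralSectionAlong {F : M → N} (K : FieldAlong k I' F) (ψ : (Fin k → ℝ) → M)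
    (U : Set (Fin k → ℝ)) : Prop :=
  ContMDiffOn 𝓘(ℝ, Fin k → ℝ) I ∞ ψ U ∧ ∀ t ∈ U, mapVel I I' F (prolong I ψ t) = K.toMap (ψ t)

variable (I) in
/-- `φ`, defined on the open set `U ⊆ ℝᵏ`, is an integral section of the `k`-vector field `X` on
`M`: `φ⁽¹⁾ = X ∘ φ`. -/
def IsIntegralSection (X : FieldAlong k I (id : M → M)) (φ : (Fin k → ℝ) → M)
    (U : Set (Fin k → ℝ)) : Prop :=
  ContMDiffOn 𝓘(ℝ, Fin k → ℝ) I ∞ φ U ∧ ∀ t ∈ U, prolong I φ t = X.toMap (φ t)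

variable (I I' I'') in
/-- The `k`-vector field `K` along `F : M → N` is integrable on the submanifold `j : S ↪ M`: through
each point of `S` there passes an integral section of `K`, defined near `0 ∈ ℝᵏ`, on `S`. -/
def IsIntegrableAlongOn {F : M → N} (K : FieldAlong k I' F) (j : S → M) : Prop :=
  ∀ s : S, ∃ U : Set (Fin k → ℝ), IsOpen U ∧ 0 ∈ U ∧ ∃ ψ : (Fin k → ℝ) → S, ψ 0 = s ∧
    ContMDiffOn 𝓘(ℝ, Fin k → ℝ) I'' ∞ ψ U ∧ IsIntegralSectionAlong I I' K (j ∘ ψ) U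

variable (I I'') in
/-- The `k`-vector field `X` on `M` is integrable on the submanifold `j : S ↪ M`: through each point
of `S` there passes an integral section of `X`, defined near `0 ∈ ℝᵏ`, on `S`. -/
def IsIntegrableOn (X : FieldAlong k I (id : M → M)) (j : S → M) : Prop :=
  ∀ s : S, ∃ U : Set (Fin k → ℝ), IsOpen U ∧ 0 ∈ U ∧ ∃ ψ : (Fin k → ℝ) → S, ψ 0 = s ∧
    ContMDiffOn 𝓘(ℝ, Fin k → ℝ) I'' ∞ ψ U ∧ IsIntegralSection I X (j ∘ ψ) U

variable (I) in
/-- `ψ : U ⊆ ℝᵏ → T¹ₖM` is holonomic: it is the first prolongation of its projection to `M`. -/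
def IsHolonomicOn (ψ : (Fin k → ℝ) → Vel k I M) (U : Set (Fin k → ℝ)) : Prop :=
  ∀ t ∈ U, ψ t = prolong I (fun t' => (ψ t').proj) t

variable (I) in
/-- The exterior derivative of a 1-form `θ` on a manifold without boundary, at `x`, computed in the
chart `φ` at `x`: for the local representative `θ' = (φ⁻¹)^*θ` of `θ`,
`dθ(ξ, η) = (Dθ'·ξ)(η) - (Dθ'·η)(ξ)`. -/
def dOneForm (θ : ∀ x : M, TangentSpace I x →L[ℝ] ℝ) (x : M) (ξ η : TangentSpace I x) : ℝ :=
  let θ' : E → E →L[ℝ] ℝ := fun y =>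
    ((θ ((extChartAt I x).symm y)).comp (mfderiv 𝓘(ℝ, E) I (extChartAt I x).symm y)).comp
      (NormedSpace.fromTangentSpace (𝕜 := ℝ) y).symm.toContinuousLinearMap
  let ξ' : E := NormedSpace.fromTangentSpace (𝕜 := ℝ) _ (mfderiv I 𝓘(ℝ, E) (extChartAt I x) x ξ)
  let η' : E := NormedSpace.fromTangentSpace (𝕜 := ℝ) _ (mfderiv I 𝓘(ℝ, E) (extChartAt I x) x η)
  fderiv ℝ θ' (extChartAt I x x) ξ' η' - fderiv ℝ θ' (extChartAt I x x) η' ξ'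

end Velocities

/-! ### Lagrangians -/

section Lagrangian

variable {k : ℕ}
  {E : Type*} [NormedAddCommGroup E] [NormedSpace ℝ E]
  {Q : Type*} [TopologicalSpace Q] [ChartedSpace E Q] [IsManifold 𝓘(ℝ, E) ∞ Q]

/-- The Liouville form `(θ_0)_A` on `(T¹ₖ)*Q`: `(θ_0)_A(α)(ξ) = αᴬ((τ_Q^*)_* ξ)`. -/
def liouville (A : Fin k) (α : Covel k 𝓘(ℝ, E) Q) :
    TangentSpace (covelModel k 𝓘(ℝ, E)) α →L[ℝ] ℝ :=
  (ContinuousLinearMap.proj (R := ℝ) (φ := fun _ : Fin k => ℝ) A).comp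
    (α.2.comp (mfderiv (covelModel k 𝓘(ℝ, E)) 𝓘(ℝ, E)
      (fun β : Covel k 𝓘(ℝ, E) Q => β.proj) α))

/-- The canonical 2-form `(ω_0)_A = -d(θ_0)_A` on `(T¹ₖ)*Q`. -/
def omega (A : Fin k) (α : Covel k 𝓘(ℝ, E) Q)
    (ξ η : TangentSpace (covelModel k 𝓘(ℝ, E)) α) : ℝ :=
  -dOneForm (covelModel k 𝓘(ℝ, E)) (liouville A) α ξ η

/-- The Legendre map `FL : T¹ₖQ → (T¹ₖ)*Q` (the fibre derivative of `L`):
`[FL(v_1, …, v_k)]ᴬ(w) = d/ds|₀ L(v_1, …, v_A + s w, …, v_k)`. -/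
def legendre (L : Vel k 𝓘(ℝ, E) Q → ℝ) (v : Vel k 𝓘(ℝ, E) Q) : Covel k 𝓘(ℝ, E) Q :=
  ⟨v.proj, ContinuousLinearMap.pi fun A =>
    (fderiv ℝ (fun u : VelFiber k 𝓘(ℝ, E) Q v.proj => L ⟨v.proj, u⟩) v.2).comp (single v.proj A)⟩

/-- The energy `E_L = C(L) - L`, where `C` is the Liouville vector field, i.e. the generator of the
flow `(s, v) ↦ eˢ v`. -/
def energy (L : Vel k 𝓘(ℝ, E) Q → ℝ) (v : Vel k 𝓘(ℝ, E) Q) : ℝ :=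
  deriv (fun s : ℝ => L ⟨v.proj, Real.exp s • v.2⟩) 0 - L v

/-- The field equation condition `∑_A FL^*[ι_{K_A} ((ω_0)_A ∘ FL)] = dE_L` at the points of `S`. -/
def FieldEquationOn (L : Vel k 𝓘(ℝ, E) Q → ℝ)
    (K : FieldAlong k (covelModel k 𝓘(ℝ, E)) (legendre L)) (S : Set (Vel k 𝓘(ℝ, E) Q)) : Prop :=
  ∀ v ∈ S, ∀ w : TangentSpace (velModel k 𝓘(ℝ, E)) v,
    ∑ A, omega A (legendre L v) (comp (K v) A)
        (mfderiv (velModel k 𝓘(ℝ, E)) (covelModel k 𝓘(ℝ, E)) (legendre L) v w)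
      = mfderiv (velModel k 𝓘(ℝ, E)) 𝓘(ℝ, ℝ) (energy L) v w

/-- The second-order condition `T¹ₖ(τ_Q^*) ∘ K = Id` at the points of `S`. -/
def SecondOrderOn {F : Vel k 𝓘(ℝ, E) Q → Covel k 𝓘(ℝ, E) Q}
    (K : FieldAlong k (covelModel k 𝓘(ℝ, E)) F) (S : Set (Vel k 𝓘(ℝ, E) Q)) : Prop :=
  ∀ v ∈ S, mapVel (covelModel k 𝓘(ℝ, E)) 𝓘(ℝ, E)
    (fun β : Covel k 𝓘(ℝ, E) Q => β.proj) (K.toMap v) = v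

/-- `K` is a field operator associated with `L`, on `S`: a `k`-vector field along `FL` (structural
condition) which satisfies the field equation condition and the second-order condition on `S`. -/
structure IsFieldOperatorOn (L : Vel k 𝓘(ℝ, E) Q → ℝ)
    (K : FieldAlong k (covelModel k 𝓘(ℝ, E)) (legendre L)) (S : Set (Vel k 𝓘(ℝ, E) Q)) :
    Prop where
  structural : IsKVectorFieldAlong (velModel k 𝓘(ℝ, E)) K
  fieldEquation : FieldEquationOn L K S
  secondOrder : SecondOrderOn K S

variable {E₀ : Type*} [NormedAddCommGroup E₀] [NormedSpace ℝ E₀]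
  {H₀ : Type*} [TopologicalSpace H₀] (I₀ : ModelWithCorners ℝ E₀ H₀)
  {P₀ : Type*} [TopologicalSpace P₀] [ChartedSpace H₀ P₀]

/-- `L` is almost-regular, where the manifold `P₀` with the embedding `j₀ : P₀ ↪ (T¹ₖ)*Q` is the
submanifold `FL(T¹ₖQ)` and `FL₀ : T¹ₖQ → P₀` is the map defined by `j₀ ∘ FL₀ = FL`.  The hyper-regular
case (`FL` a diffeomorphism) is contained here, with `P₀ = (T¹ₖ)*Q`, `j₀ = id` and `FL₀ = FL`. -/
structure IsAlmostRegular (L : Vel k 𝓘(ℝ, E) Q → ℝ) (j₀ : P₀ → Covel k 𝓘(ℝ, E) Q)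
    (FL₀ : Vel k 𝓘(ℝ, E) Q → P₀) : Prop where
  embedding : Manifold.IsSmoothEmbedding I₀ (covelModel k 𝓘(ℝ, E)) ∞ j₀
  range_eq : Set.range j₀ = Set.range (legendre L)
  isClosed : IsClosed (Set.range (legendre L))
  factor : ∀ v, j₀ (FL₀ v) = legendre L v
  submersion : Manifold.IsSubmersion (velModel k 𝓘(ℝ, E)) I₀ ∞ FL₀
  connected : ∀ v, IsConnected {v' | legendre L v' = legendre L v}

/-- `X₀` is a solution, at the points of `P ⊆ P₀`, of the Hamiltonian field equation
`∑_A ι_{(X₀)_A} j₀^*(ω_0)_A = dh₀`, where `h₀ ∈ C^∞(P₀)` is the function with `FL₀^* h₀ = E_L`. -/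
def HamiltonEquationOn (L : Vel k 𝓘(ℝ, E) Q → ℝ) (j₀ : P₀ → Covel k 𝓘(ℝ, E) Q)
    (FL₀ : Vel k 𝓘(ℝ, E) Q → P₀) (X₀ : FieldAlong k I₀ (id : P₀ → P₀)) (P : Set P₀) : Prop :=
  ∃ h₀ : P₀ → ℝ, ContMDiff I₀ 𝓘(ℝ, ℝ) ∞ h₀ ∧ (∀ v, h₀ (FL₀ v) = energy L v) ∧
    ∀ p ∈ P, ∀ η : TangentSpace I₀ p,
      ∑ A, omega A (j₀ p)
          (mfderiv I₀ (covelModel k 𝓘(ℝ, E)) j₀ p (comp (k := k) (x := p) (X₀ p) A))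
          (mfderiv I₀ (covelModel k 𝓘(ℝ, E)) j₀ p η)
        = mfderiv I₀ 𝓘(ℝ, ℝ) h₀ p η

end Lagrangian

end KSymplectic

end

/-!
The relations between integral sections all rest on the chain rule for prolongations,
`T¹ₖF ∘ φ⁽¹⁾ = (F ∘ φ)⁽¹⁾` (`mapVel_prolong`).

Since `FL = j₀ ∘ FL₀` and `K = T¹ₖj₀ ∘ X₀ ∘ FL₀` on `S`, the equation `T¹ₖFL ∘ ψ⁽¹⁾ = K ∘ ψ` is the
image under `T¹ₖj₀` of `(FL₀ ∘ ψ)⁽¹⁾ = X₀ ∘ FL₀ ∘ ψ`.  As `j₀` is an injective immersion, `T¹ₖj₀` is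
injective, so for maps `ψ` into `S` the two equations are equivalent (`mapVel_prolong_eq_iff`).  Hence
integral sections of `K` project to integral sections of `X₀`, and smooth lifts of integral sections
of `X₀` are integral sections of `K`; smoothness of maps into the embedded submanifolds can be
tested in the ambient manifolds.  Applying `T¹ₖ(τ_Q^*)` to `T¹ₖFL ∘ ψ⁽¹⁾ = K ∘ ψ` and using
`τ_Q^* ∘ FL = τ_Q` gives `(τ_Q ∘ ψ)⁽¹⁾ = T¹ₖ(τ_Q^*) ∘ K ∘ ψ`, so that holonomy of `ψ` is the
second-order condition along `ψ`.

To pass from integrability of `X₀` to that of `K`, integral sections have to be lifted through a given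
point of `S`.  If `FL_S` is a submersion, a local section of it does this.  If `K` satisfies the
second-order condition on `S`, then `s = T¹ₖ(τ_Q^* ∘ j₀) (X₀ (FL₀ s))` for `s ∈ S`, so `FL_S` is
bijective; its inverse carries an integral section `ψ_P` of `X₀` to the prolongation of
`τ_Q^* ∘ j₀ ∘ j_P ∘ ψ_P`, which is smooth (`ContMDiffAt.prolong`).

Finally, the Hamiltonian field equation pulls back under `FL₀` to the field equation for `K`
(`fieldEquation_of_hamiltonEquation`); only the chain rule is used, no property of the canonical forms.
-/

/-! ### Local retractions of immersions and local sections of submersions -/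

namespace Manifold

variable {E : Type*} [NormedAddCommGroup E] [NormedSpace ℝ E]
  {H : Type*} [TopologicalSpace H] {I : ModelWithCorners ℝ E H}
  {M : Type*} [TopologicalSpace M] [ChartedSpace H M]
  {E' : Type*} [NormedAddCommGroup E'] [NormedSpace ℝ E']
  {H' : Type*} [TopologicalSpace H'] {I' : ModelWithCorners ℝ E' H'}
  {N : Type*} [TopologicalSpace N] [ChartedSpace H' N] {n : ℕ∞ω}

/-- Without boundary, the inverse of an extended chart is smooth at, not merely within, its target. -/
lemma contMDiffAt_extend_symm [I.Boundaryless] {φ : OpenPartialHomeomorph M H}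
    (hφ : φ ∈ IsManifold.maximalAtlas I n M) {u : E} (hu : u ∈ (φ.extend I).target) :
    ContMDiffAt 𝓘(ℝ, E) I n (φ.extend I).symm u := by
  refine (contMDiffOn_extend_symm hφ).contMDiffAt ?_
  rw [← φ.extend_target']
  exact φ.isOpen_extend_target.mem_nhds hu

/-- In slice charts an immersion is `u ↦ (u, 0)`, so that `(u, w) ↦ u` is a local retraction. -/
lemma IsImmersionAt.exists_local_leftInverse [I.Boundaryless] {f : M → N} {x : M}
    (h : IsImmersionAt I I' n f x) :
    ∃ r : N → M, ContMDiffAt I' I n r (f x) ∧ ∀ᶠ y in 𝓝 x, r (f y) = y := by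
  have key : ∀ y ∈ h.domChart.source,
      h.equiv.symm (h.codChart.extend I' (f y)) = (h.domChart.extend I y, 0) := by
    intro y hy
    rw [ContinuousLinearEquiv.symm_apply_eq]
    have := h.writtenInCharts ((h.domChart.extend I).map_source (by simpa using hy))
    rwa [Function.comp_apply, Function.comp_apply, h.domChart.extend_left_inv hy] at this
  have hx := h.mem_domChart_source
  refine ⟨(h.domChart.extend I).symm ∘ (fun z ↦ (h.equiv.symm z).1) ∘ h.codChart.extend I', ?_, ?_⟩
  · have h1 := h.codChart.contMDiffAt_extend h.codChart_mem_maximalAtlas h.mem_codChart_source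
    have h2 : ContMDiffAt 𝓘(ℝ, E') 𝓘(ℝ, E) n (fun z ↦ (h.equiv.symm z).1)
        (h.codChart.extend I' (f x)) := by
      rw [contMDiffAt_iff_contDiffAt]; fun_prop
    have h3 : ContMDiffAt 𝓘(ℝ, E) I n (h.domChart.extend I).symm (h.domChart.extend I x) :=
      contMDiffAt_extend_symm h.domChart_mem_maximalAtlas
        ((h.domChart.extend I).map_source (by simpa using hx))
    exact h3.comp_of_eq (h2.comp (f x) h1) (congrArg Prod.fst (key x hx))
  · filter_upwards [h.domChart.open_source.mem_nhds hx] with y hy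
    simp only [Function.comp_apply, key y hy, h.domChart.extend_left_inv hy]

/-- In adapted charts a submersion is `(u, w) ↦ u`, so that `u ↦ (u, w₀)` is a local section,
which passes through the given point if `w₀` is the second coordinate of that point.  Smoothness is
asserted on a neighbourhood, since for `n = ∞` it does not follow from smoothness at `f x`. -/
lemma IsSubmersionAt.exists_local_section [I.Boundaryless] {f : M → N} {x : M}
    (h : IsSubmersionAt I I' n f x) :
    ∃ σ : N → M, σ (f x) = x ∧ ∀ᶠ y in 𝓝 (f x), ContMDiffAt I' I n σ y ∧ f (σ y) = y := by
  have hx := h.mem_domChart_source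
  have hxt : h.domChart.extend I x ∈ (h.domChart.extend I).target :=
    (h.domChart.extend I).map_source (by simpa using hx)
  set w := (h.equiv (h.domChart.extend I x)).2
  set g : N → E := fun y ↦ h.equiv.symm (h.codChart.extend I' y, w)
  have hgx : g (f x) = h.domChart.extend I x := by
    have := h.writtenInCharts hxt
    rw [Function.comp_apply, Function.comp_apply, h.domChart.extend_left_inv hx] at this
    simp only [g]
    rw [this, ContinuousLinearEquiv.symm_apply_eq]
    rfl
  have hg : ∀ y ∈ h.codChart.source, ContMDiffAt I' 𝓘(ℝ, E) n g y := by
    intro y hy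
    have h1 := h.codChart.contMDiffAt_extend h.codChart_mem_maximalAtlas hy
    have h2 : ContMDiffAt 𝓘(ℝ, E') 𝓘(ℝ, E) n (fun z ↦ h.equiv.symm (z, w))
        (h.codChart.extend I' y) := by
      rw [contMDiffAt_iff_contDiffAt]; fun_prop
    exact h2.comp y h1
  refine ⟨(h.domChart.extend I).symm ∘ g, ?_, ?_⟩
  · rw [Function.comp_apply, hgx, h.domChart.extend_left_inv hx]
  · have hgt : ∀ᶠ y in 𝓝 (f x), g y ∈ (h.domChart.extend I).target :=
      (hg _ h.mem_codChart_source).continuousAt.eventually_mem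
        (hgx ▸ h.domChart.isOpen_extend_target.mem_nhds hxt)
    filter_upwards [hgt, h.codChart.open_source.mem_nhds h.mem_codChart_source] with y hy hyc
    refine ⟨(contMDiffAt_extend_symm h.domChart_mem_maximalAtlas hy).comp y (hg y hyc), ?_⟩
    have h1 := h.writtenInCharts hy
    have h2 : (h.domChart.extend I).symm (g y) ∈ h.domChart.source := by
      simpa using (h.domChart.extend I).map_target hy
    refine (h.codChart.extend I').injOn ?_ ?_ (h1.trans ?_)
    · simpa using h.source_subset_preimage_source h2
    · simpa using hyc
    · simp only [Function.comp_apply, g, ContinuousLinearEquiv.apply_symm_apply]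

lemma IsImmersionAt.injective_mfderiv [I.Boundaryless] {f : M → N} {x : M}
    (h : IsImmersionAt I I' n f x) (hn : n ≠ 0) :
    Function.Injective (mfderiv I I' f x) := by
  obtain ⟨r, hr, hrf⟩ := h.exists_local_leftInverse
  have hid : HasMFDerivAt I I (r ∘ f) x ((mfderiv I' I r (f x)).comp (mfderiv I I' f x)) :=
    (hr.mdifferentiableAt hn).hasMFDerivAt.comp x (h.contMDiffAt.mdifferentiableAt hn).hasMFDerivAt
  have hid' : HasMFDerivAt I I (r ∘ f) x (ContinuousLinearMap.id ℝ (TangentSpace I x)) :=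
    (hasMFDerivAt_id x).congr_of_eventuallyEq hrf
  have h0 := hasMFDerivAt_unique hid hid'
  intro v w hvw
  have := congrArg (mfderiv I' I r (f x)) hvw
  have e : ∀ v, mfderiv I' I r (f x) (mfderiv I I' f x v) = v := fun v ↦ DFunLike.congr_fun h0 v
  exact (e v).symm.trans (this.trans (e w))

/-- A map into an embedded submanifold is smooth as soon as it is smooth as a map into the ambient
manifold. -/
lemma IsSmoothEmbedding.contMDiffAt_of_comp {E'' : Type*} [NormedAddCommGroup E'']
    [NormedSpace ℝ E''] {H'' : Type*} [TopologicalSpace H''] {I'' : ModelWithCorners ℝ E'' H''}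
    {X : Type*} [TopologicalSpace X] [ChartedSpace H'' X] {j : M → N} {f : X → M} {x : X}
    (hj : IsSmoothEmbedding I I' n j) (h : ContMDiffAt I'' I' n (j ∘ f) x) :
    ContMDiffAt I'' I n f x :=
  (ContMDiffAt.iff_comp_isImmersionAt (hj.isImmersion.isImmersionAt (f x))).2
    ⟨hj.isEmbedding.isInducing.continuousAt_iff.2 h.continuousAt, h⟩

end Manifold

/-! ### Prolongations and induced maps -/

namespace KSymplectic
open Manifold

variable {k : ℕ}
  {E : Type*} [NormedAddCommGroup E] [NormedSpace ℝ E]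
  {H : Type*} [TopologicalSpace H] {I : ModelWithCorners ℝ E H}
  {M : Type*} [TopologicalSpace M] [ChartedSpace H M]
  {E' : Type*} [NormedAddCommGroup E'] [NormedSpace ℝ E']
  {H' : Type*} [TopologicalSpace H'] {I' : ModelWithCorners ℝ E' H'}
  {N : Type*} [TopologicalSpace N] [ChartedSpace H' N]
  {E₀ : Type*} [NormedAddCommGroup E₀] [NormedSpace ℝ E₀]
  {H₀ : Type*} [TopologicalSpace H₀] {I₀ : ModelWithCorners ℝ E₀ H₀}
  {P₀ : Type*} [TopologicalSpace P₀] [ChartedSpace H₀ P₀]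

/-- The chain rule `T¹ₖF ∘ φ⁽¹⁾ = (F ∘ φ)⁽¹⁾`. -/
lemma mapVel_prolong {F : M → N} {φ : (Fin k → ℝ) → M} {t : Fin k → ℝ}
    (hF : MDifferentiableAt I I' F (φ t)) (hφ : MDifferentiableAt 𝓘(ℝ, Fin k → ℝ) I φ t) :
    mapVel I I' F (prolong I φ t) = prolong I' (F ∘ φ) t := by
  simp only [mapVel, prolong, mfderiv_comp t hF hφ]
  rfl

lemma _root_.Filter.EventuallyEq.prolong_eq {φ φ' : (Fin k → ℝ) → M} {t : Fin k → ℝ}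
    (h : φ =ᶠ[𝓝 t] φ') : prolong I φ t = prolong I φ' t := by
  have h1 : φ t = φ' t := h.eq_of_nhds
  have h2 : (mfderiv 𝓘(ℝ, Fin k → ℝ) I φ t : (Fin k → ℝ) →L[ℝ] E) =
      mfderiv 𝓘(ℝ, Fin k → ℝ) I φ' t := h.mfderiv_eq
  have aux : ∀ {x y : M} {A B : (Fin k → ℝ) →L[ℝ] E}, x = y → A = B →
      (⟨x, A⟩ : Vel k I M) = ⟨y, B⟩ := by
    rintro x y A B rfl rfl
    rfl
  exact aux h1 h2

/-- `T¹ₖj` is injective for an injective immersion `j`. -/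
lemma mapVel_injective {j : P₀ → N} (hj : Function.Injective j)
    (hj' : ∀ p, Function.Injective (mfderiv I₀ I' j p)) :
    Function.Injective (mapVel (k := k) I₀ I' j) := by
  rintro ⟨p, v⟩ ⟨q, w⟩ h
  obtain rfl : p = q := hj (congrArg Bundle.TotalSpace.proj h)
  have h2 : (mfderiv I₀ I' j p).comp v = (mfderiv I₀ I' j p).comp w :=
    eq_of_heq (Bundle.TotalSpace.mk.inj h).2
  congr 1
  ext u
  exact hj' p (DFunLike.congr_fun h2 u)

lemma _root_.ContMDiffAt.prolong [IsManifold I ∞ M] {φ : (Fin k → ℝ) → M} {t : Fin k → ℝ}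
    (hφ : ContMDiffAt 𝓘(ℝ, Fin k → ℝ) I ∞ φ t) :
    ContMDiffAt 𝓘(ℝ, Fin k → ℝ) (velModel k I) ∞ (prolong I φ) t := by
  rw [contMDiffAt_hom_bundle]
  refine ⟨hφ, ?_⟩
  have h := hφ.mfderiv_const (m := ∞) (n := ∞) le_rfl
  refine h.congr_of_eventuallyEq (.of_forall fun t' ↦ ?_)
  -- Both trivial bundles, over `M` and over `ℝᵏ`, have the identity as local trivialization.
  have h1 : ((trivializationAt (Fin k → ℝ) (Bundle.Trivial M (Fin k → ℝ)) (φ t)).symmL ℝ (φ t') :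
      (Fin k → ℝ) →L[ℝ] (Fin k → ℝ)) = .id ℝ (Fin k → ℝ) :=
    Bundle.Trivial.symmL_trivialization ℝ M (Fin k → ℝ) (φ t')
  have h2 : ((trivializationAt (Fin k → ℝ) (TangentSpace 𝓘(ℝ, Fin k → ℝ)) t).symmL ℝ t' :
      (Fin k → ℝ) →L[ℝ] (Fin k → ℝ)) = .id ℝ (Fin k → ℝ) :=
    TangentBundle.symmL_model_space t t'
  exact congrArg (fun A : (Fin k → ℝ) →L[ℝ] (Fin k → ℝ) ↦
    ((trivializationAt E (TangentSpace I) (φ t)).continuousLinearMapAt ℝ (φ t')).comp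
      ((mfderiv 𝓘(ℝ, Fin k → ℝ) I φ t' : (Fin k → ℝ) →L[ℝ] E).comp A)) (h1.trans h2.symm)

/-! ### Integral sections of related fields, second-order condition and field equations -/

/-- Let `F = j ∘ q` with `T¹ₖj` injective, and let `K = T¹ₖj ∘ X ∘ q` at `ψ t`.  Then `ψ` solves the
equation of integral sections of `K` at `t` iff `q ∘ ψ` solves that of `X`: the former equation is
the image of the latter under `T¹ₖj`. -/
lemma mapVel_prolong_eq_iff {F : M → N} {j : P₀ → N} {q : M → P₀}
    (hF : ∀ v, j (q v) = F v) (hj : MDifferentiable I₀ I' j)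
    (hinj : Function.Injective (mapVel (k := k) I₀ I' j))
    (hq : MDifferentiable I I₀ q) {K : FieldAlong k I' F} {X : FieldAlong k I₀ (id : P₀ → P₀)}
    {ψ : (Fin k → ℝ) → M} {t : Fin k → ℝ} (hψ : MDifferentiableAt 𝓘(ℝ, Fin k → ℝ) I ψ t)
    (hrel : mapVel I₀ I' j (X.toMap (q (ψ t))) = K.toMap (ψ t)) :
    mapVel I I' F (prolong I ψ t) = K.toMap (ψ t) ↔
      prolong I₀ (q ∘ ψ) t = X.toMap (q (ψ t)) := by
  obtain rfl : j ∘ q = F := funext hF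
  rw [← hrel, mapVel_prolong ((hj _).comp _ (hq _)) hψ, Function.comp_assoc,
    ← mapVel_prolong (hj _) ((hq _).comp _ hψ), hinj.eq_iff]

section Lagrangian

variable {Q : Type*} [TopologicalSpace Q] [ChartedSpace E Q] [IsManifold 𝓘(ℝ, E) ∞ Q]

lemma mdifferentiable_covel_proj :
    MDifferentiable (covelModel k 𝓘(ℝ, E)) 𝓘(ℝ, E) (fun β : Covel k 𝓘(ℝ, E) Q ↦ β.proj) :=
  (Bundle.contMDiff_proj (n := 1) (CovelFiber k 𝓘(ℝ, E) Q)).mdifferentiable one_ne_zero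

/-- Along an integral section `ψ` of a `k`-vector field `K` along a fibre-preserving map `F`,
`T¹ₖ(τ_Q^*) ∘ K ∘ ψ = (τ_Q ∘ ψ)⁽¹⁾`: the second-order condition at `ψ t` says that `ψ` is holonomic
at `t`. -/
lemma mapVel_proj_toMap_of_section {F : Vel k 𝓘(ℝ, E) Q → Covel k 𝓘(ℝ, E) Q}
    (hF : MDifferentiable (velModel k 𝓘(ℝ, E)) (covelModel k 𝓘(ℝ, E)) F)
    (hproj : ∀ v, (F v).proj = v.proj)
    {K : FieldAlong k (covelModel k 𝓘(ℝ, E)) F} {ψ : (Fin k → ℝ) → Vel k 𝓘(ℝ, E) Q}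
    {t : Fin k → ℝ} (hψ : MDifferentiableAt 𝓘(ℝ, Fin k → ℝ) (velModel k 𝓘(ℝ, E)) ψ t)
    (h : mapVel (velModel k 𝓘(ℝ, E)) (covelModel k 𝓘(ℝ, E)) F (prolong _ ψ t) = K.toMap (ψ t)) :
    mapVel (covelModel k 𝓘(ℝ, E)) 𝓘(ℝ, E) (fun β : Covel k 𝓘(ℝ, E) Q ↦ β.proj) (K.toMap (ψ t)) =
      prolong 𝓘(ℝ, E) (fun t' ↦ (ψ t').proj) t := by
  rw [← h, mapVel_prolong (hF _) hψ,
    mapVel_prolong (mdifferentiable_covel_proj _) ((hF _).comp _ hψ)]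
  congr 1
  exact funext fun t' ↦ hproj (ψ t')

/-- Rewriting of the arguments of `(ω_0)_A` along an equality of base points, under which the
fibres are only propositionally the same. -/
lemma omega_congr {α β : Covel k 𝓘(ℝ, E) Q}
    {κ : VelFiber k (covelModel k 𝓘(ℝ, E)) (Covel k 𝓘(ℝ, E) Q) α}
    {κ' : VelFiber k (covelModel k 𝓘(ℝ, E)) (Covel k 𝓘(ℝ, E) Q) β}
    (h : (⟨α, κ⟩ : Vel k (covelModel k 𝓘(ℝ, E)) (Covel k 𝓘(ℝ, E) Q)) = ⟨β, κ'⟩)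
    {ξ ξ' : E × (E →L[ℝ] (Fin k → ℝ))} (hξ : ξ = ξ') (A : Fin k) :
    omega A α (comp κ A) ξ = omega A β (comp κ' A) ξ' := by
  cases h
  rw [hξ]

/-- If `X₀` satisfies the Hamiltonian field equation on `FL₀(S)` and is related to `K` on `S`, then
the pullback of that equation under `FL₀` is the field equation for `K` on `S`. -/
lemma fieldEquation_of_hamiltonEquation {L : Vel k 𝓘(ℝ, E) Q → ℝ} {j₀ : P₀ → Covel k 𝓘(ℝ, E) Q}
    {FL₀ : Vel k 𝓘(ℝ, E) Q → P₀} (hF : ∀ v, j₀ (FL₀ v) = legendre L v)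
    (hj : MDifferentiable I₀ (covelModel k 𝓘(ℝ, E)) j₀)
    (hq : MDifferentiable (velModel k 𝓘(ℝ, E)) I₀ FL₀)
    {K : FieldAlong k (covelModel k 𝓘(ℝ, E)) (legendre L)}
    {X₀ : FieldAlong k I₀ (id : P₀ → P₀)} {S : Set (Vel k 𝓘(ℝ, E) Q)}
    (hrel : ∀ v ∈ S, mapVel I₀ (covelModel k 𝓘(ℝ, E)) j₀ (X₀.toMap (FL₀ v)) = K.toMap v)
    (h : HamiltonEquationOn I₀ L j₀ FL₀ X₀ (FL₀ '' S)) : FieldEquationOn L K S := by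
  obtain ⟨h₀, hh₀, hE, hX⟩ := h
  intro v hv w
  have hL : legendre L = j₀ ∘ FL₀ := funext fun v ↦ (hF v).symm
  have hEL : energy L = h₀ ∘ FL₀ := funext fun v ↦ (hE v).symm
  have hdL : (mfderiv (velModel k 𝓘(ℝ, E)) (covelModel k 𝓘(ℝ, E)) (legendre L) v w :
      E × (E →L[ℝ] (Fin k → ℝ))) =
      mfderiv I₀ (covelModel k 𝓘(ℝ, E)) j₀ (FL₀ v) (mfderiv (velModel k 𝓘(ℝ, E)) I₀ FL₀ v w) :=
    (congrArg (fun G : Vel k 𝓘(ℝ, E) Q → Covel k 𝓘(ℝ, E) Q ↦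
      (mfderiv (velModel k 𝓘(ℝ, E)) (covelModel k 𝓘(ℝ, E)) G v w :
        E × (E →L[ℝ] (Fin k → ℝ)))) hL).trans
      (DFunLike.congr_fun (mfderiv_comp v (hj _) (hq v)) w)
  have hdE : (mfderiv (velModel k 𝓘(ℝ, E)) 𝓘(ℝ, ℝ) (energy L) v w : ℝ) =
      mfderiv I₀ 𝓘(ℝ, ℝ) h₀ (FL₀ v) (mfderiv (velModel k 𝓘(ℝ, E)) I₀ FL₀ v w) :=
    (congrArg (fun G : Vel k 𝓘(ℝ, E) Q → ℝ ↦
      (mfderiv (velModel k 𝓘(ℝ, E)) 𝓘(ℝ, ℝ) G v w : ℝ)) hEL).trans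
      (DFunLike.congr_fun (mfderiv_comp v ((hh₀.mdifferentiable (by simp)) _) (hq v)) w)
  refine Eq.trans (Finset.sum_congr rfl fun A _ ↦ ?_)
    ((hX (FL₀ v) ⟨v, hv, rfl⟩ (mfderiv (velModel k 𝓘(ℝ, E)) I₀ FL₀ v w)).trans hdE.symm)
  exact omega_congr (hrel v hv).symm hdL A

end Lagrangian
end KSymplectic

/-! ### Integrability of related fields -/

open KSymplectic in
theorem mainTheorem5 (k : ℕ)
    -- the configuration manifold `Q`
    {E : Type*} [NormedAddCommGroup E] [NormedSpace ℝ E] [FiniteDimensional ℝ E]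
    {Q : Type*} [TopologicalSpace Q] [ChartedSpace E Q] [IsManifold 𝓘(ℝ, E) ∞ Q]
    [T2Space Q] [ParacompactSpace Q] [ConnectedSpace Q]
    -- the manifold `P₀ = FL(T¹ₖQ)`
    {E₀ : Type*} [NormedAddCommGroup E₀] [NormedSpace ℝ E₀] [FiniteDimensional ℝ E₀]
    {H₀ : Type*} [TopologicalSpace H₀] (I₀ : ModelWithCorners ℝ E₀ H₀) [I₀.Boundaryless]
    {P₀ : Type*} [TopologicalSpace P₀] [ChartedSpace H₀ P₀] [IsManifold I₀ ∞ P₀]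
    -- the submanifold `S` of `T¹ₖQ`
    {E₁ : Type*} [NormedAddCommGroup E₁] [NormedSpace ℝ E₁] [FiniteDimensional ℝ E₁]
    {H₁ : Type*} [TopologicalSpace H₁] (I₁ : ModelWithCorners ℝ E₁ H₁) [I₁.Boundaryless]
    {S : Type*} [TopologicalSpace S] [ChartedSpace H₁ S] [IsManifold I₁ ∞ S]
    -- the submanifold `P` of `P₀`
    {E₂ : Type*} [NormedAddCommGroup E₂] [NormedSpace ℝ E₂] [FiniteDimensional ℝ E₂]
    {H₂ : Type*} [TopologicalSpace H₂] (I₂ : ModelWithCorners ℝ E₂ H₂) [I₂.Boundaryless]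
    {P : Type*} [TopologicalSpace P] [ChartedSpace H₂ P] [IsManifold I₂ ∞ P]
    -- the almost-regular (or hyper-regular) Lagrangian
    (L : Vel k 𝓘(ℝ, E) Q → ℝ) (hL : ContMDiff (velModel k 𝓘(ℝ, E)) 𝓘(ℝ, ℝ) ∞ L)
    (j₀ : P₀ → Covel k 𝓘(ℝ, E) Q) (FL₀ : Vel k 𝓘(ℝ, E) Q → P₀)
    (hreg : IsAlmostRegular I₀ L j₀ FL₀)
    -- `S ↪ T¹ₖQ`, `P = FL₀(S) ↪ P₀` and the restriction `FL_S : S → P` of `FL₀`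
    (jS : S → Vel k 𝓘(ℝ, E) Q) (hjS : Manifold.IsSmoothEmbedding I₁ (velModel k 𝓘(ℝ, E)) ∞ jS)
    (jP : P → P₀) (hjP : Manifold.IsSmoothEmbedding I₂ I₀ ∞ jP)
    (hP : Set.range jP = FL₀ '' Set.range jS)
    (FLS : S → P) (hFLS : ∀ s, jP (FLS s) = FL₀ (jS s))
    -- the `k`-vector field `K` along `FL` and the `k`-vector field `X₀` on `P₀`
    (K : FieldAlong k (covelModel k 𝓘(ℝ, E)) (legendre L))
    (hK : IsKVectorFieldAlong (velModel k 𝓘(ℝ, E)) K)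
    (X₀ : FieldAlong k I₀ (id : P₀ → P₀)) (hX₀ : IsKVectorFieldAlong I₀ X₀)
    -- `T¹ₖj₀ ∘ X₀ ∘ FL₀ = K` on `S`
    (hrel : ∀ s : S, mapVel I₀ (covelModel k 𝓘(ℝ, E)) j₀ (X₀.toMap (FL₀ (jS s))) = K.toMap (jS s))
    -- one of the (equivalent) field equations holds
    (heq : FieldEquationOn L K (Set.range jS) ∨ HamiltonEquationOn I₀ L j₀ FL₀ X₀ (Set.range jP)) :
    -- integrability of `K` on `S` and of `X₀` on `P`
    (IsIntegrableAlongOn (velModel k 𝓘(ℝ, E)) (covelModel k 𝓘(ℝ, E)) I₁ K jS →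
      IsIntegrableOn I₀ I₂ X₀ jP) ∧
    (SecondOrderOn K (Set.range jS) ∨ Manifold.IsSubmersion I₁ I₂ ∞ FLS →
      (IsIntegrableAlongOn (velModel k 𝓘(ℝ, E)) (covelModel k 𝓘(ℝ, E)) I₁ K jS ↔
        IsIntegrableOn I₀ I₂ X₀ jP)) ∧
    -- integral sections of `K` on `S` are mapped by `FL_S` to integral sections of `X₀` on `P`
    (∀ (U : Set (Fin k → ℝ)) (ψS : (Fin k → ℝ) → S), IsOpen U →
      ContMDiffOn 𝓘(ℝ, Fin k → ℝ) I₁ ∞ ψS U →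
      IsIntegralSectionAlong (velModel k 𝓘(ℝ, E)) (covelModel k 𝓘(ℝ, E)) K (jS ∘ ψS) U →
        ContMDiffOn 𝓘(ℝ, Fin k → ℝ) I₂ ∞ (FLS ∘ ψS) U ∧
        IsIntegralSection I₀ X₀ (jP ∘ FLS ∘ ψS) U) ∧
    -- every lift of an integral section of `X₀` on `P` is an integral section of `K` on `S`, and
    -- it is holonomic iff `K` satisfies the second-order condition along it
    (∀ (U : Set (Fin k → ℝ)) (ψP : (Fin k → ℝ) → P) (ψS : (Fin k → ℝ) → S), IsOpen U →
      ContMDiffOn 𝓘(ℝ, Fin k → ℝ) I₂ ∞ ψP U → IsIntegralSection I₀ X₀ (jP ∘ ψP) U →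
      ContMDiffOn 𝓘(ℝ, Fin k → ℝ) I₁ ∞ ψS U → (∀ t ∈ U, ψP t = FLS (ψS t)) →
        IsIntegralSectionAlong (velModel k 𝓘(ℝ, E)) (covelModel k 𝓘(ℝ, E)) K (jS ∘ ψS) U ∧
        (IsHolonomicOn 𝓘(ℝ, E) (jS ∘ ψS) U ↔ SecondOrderOn K ((jS ∘ ψS) '' U))) ∧
    -- for integrable `K`: all lifts are holonomic iff `K` satisfies the second-order condition on `S`
    (IsIntegrableAlongOn (velModel k 𝓘(ℝ, E)) (covelModel k 𝓘(ℝ, E)) I₁ K jS →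
      ((∀ (U : Set (Fin k → ℝ)) (ψP : (Fin k → ℝ) → P) (ψS : (Fin k → ℝ) → S), IsOpen U →
          ContMDiffOn 𝓘(ℝ, Fin k → ℝ) I₂ ∞ ψP U → IsIntegralSection I₀ X₀ (jP ∘ ψP) U →
          ContMDiffOn 𝓘(ℝ, Fin k → ℝ) I₁ ∞ ψS U → (∀ t ∈ U, ψP t = FLS (ψS t)) →
            IsHolonomicOn 𝓘(ℝ, E) (jS ∘ ψS) U) ↔
        SecondOrderOn K (Set.range jS))) ∧
    -- and in that case `K` is a field operator on `S`
    (SecondOrderOn K (Set.range jS) → IsFieldOperatorOn L K (Set.range jS)) := by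
  have hj₀ := hreg.embedding
  have hj₀d : MDifferentiable I₀ (covelModel k 𝓘(ℝ, E)) j₀ := hj₀.contMDiff.mdifferentiable (by simp)
  have hFL₀ : ContMDiff (velModel k 𝓘(ℝ, E)) I₀ ∞ FL₀ := hreg.submersion.contMDiff
  have hFL₀d := hFL₀.mdifferentiable (by simp)
  have hj₀inj : Function.Injective (mapVel (k := k) I₀ (covelModel k 𝓘(ℝ, E)) j₀) :=
    mapVel_injective hj₀.isEmbedding.injective fun p ↦
      (hj₀.isImmersion.isImmersionAt p).injective_mfderiv (by simp)
  have hFL : MDifferentiable (velModel k 𝓘(ℝ, E)) (covelModel k 𝓘(ℝ, E)) (legendre L) := by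
    rw [show legendre L = j₀ ∘ FL₀ from funext fun v ↦ (hreg.factor v).symm]
    exact hj₀d.comp hFL₀d
  have hcomp : jP ∘ FLS = FL₀ ∘ jS := funext hFLS
  have hFLSsm : ContMDiff I₁ I₂ ∞ FLS := fun s ↦ hjP.contMDiffAt_of_comp <| by
    rw [hcomp]
    exact (hFL₀.comp hjS.contMDiff) s
  have hFLSsurj : Function.Surjective FLS := by
    intro p
    obtain ⟨_, ⟨s, rfl⟩, hs⟩ : jP p ∈ FL₀ '' Set.range jS := hP ▸ Set.mem_range_self p
    exact ⟨s, hjP.isEmbedding.injective ((hFLS s).trans hs)⟩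
  -- Sections of `K` project to sections of `X₀`.
  have project : ∀ (U : Set (Fin k → ℝ)) (ψS : (Fin k → ℝ) → S), IsOpen U →
      ContMDiffOn 𝓘(ℝ, Fin k → ℝ) I₁ ∞ ψS U →
      IsIntegralSectionAlong (velModel k 𝓘(ℝ, E)) (covelModel k 𝓘(ℝ, E)) K (jS ∘ ψS) U →
        ContMDiffOn 𝓘(ℝ, Fin k → ℝ) I₂ ∞ (FLS ∘ ψS) U ∧
        IsIntegralSection I₀ X₀ (jP ∘ FLS ∘ ψS) U := by
    intro U ψS hU hψS hψ
    have hsm := hFLSsm.comp_contMDiffOn hψS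
    refine ⟨hsm, hjP.contMDiff.comp_contMDiffOn hsm, fun t ht ↦ ?_⟩
    have h := (mapVel_prolong_eq_iff hreg.factor hj₀d hj₀inj hFL₀d
      ((hψ.1.contMDiffAt (hU.mem_nhds ht)).mdifferentiableAt (by simp)) (hrel (ψS t))).1 (hψ.2 t ht)
    rw [← Function.comp_assoc, hcomp]
    exact h
  -- Lifts of sections of `X₀` are sections of `K`.
  have lift : ∀ (U : Set (Fin k → ℝ)) (ψP : (Fin k → ℝ) → P) (ψS : (Fin k → ℝ) → S), IsOpen U →
      IsIntegralSection I₀ X₀ (jP ∘ ψP) U →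
      ContMDiffOn 𝓘(ℝ, Fin k → ℝ) I₁ ∞ ψS U → (∀ t ∈ U, ψP t = FLS (ψS t)) →
        IsIntegralSectionAlong (velModel k 𝓘(ℝ, E)) (covelModel k 𝓘(ℝ, E)) K (jS ∘ ψS) U := by
    intro U ψP ψS hU hψ hψS hlift
    have hsm := hjS.contMDiff.comp_contMDiffOn hψS
    refine ⟨hsm, fun t ht ↦ ?_⟩
    refine (mapVel_prolong_eq_iff hreg.factor hj₀d hj₀inj hFL₀d
      ((hsm.contMDiffAt (hU.mem_nhds ht)).mdifferentiableAt (by simp)) (hrel (ψS t))).2 ?_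
    have hp : ∀ t ∈ U, (jP ∘ ψP) t = (FL₀ ∘ jS ∘ ψS) t := fun t ht ↦ by
      simp only [Function.comp_apply, hlift t ht, hFLS]
    rw [← (Filter.eventuallyEq_of_mem (hU.mem_nhds ht) hp).prolong_eq, hψ.2 t ht]
    exact congrArg X₀.toMap (hp t ht)
  have holonomic : ∀ (U : Set (Fin k → ℝ)) (ψ : (Fin k → ℝ) → Vel k 𝓘(ℝ, E) Q), IsOpen U →
      IsIntegralSectionAlong (velModel k 𝓘(ℝ, E)) (covelModel k 𝓘(ℝ, E)) K ψ U →
      (IsHolonomicOn 𝓘(ℝ, E) ψ U ↔ SecondOrderOn K (ψ '' U)) := by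
    intro U ψ hU hψ
    have h : ∀ t ∈ U, _ := fun t ht ↦ mapVel_proj_toMap_of_section hFL (fun _ ↦ rfl)
      ((hψ.1.contMDiffAt (hU.mem_nhds ht)).mdifferentiableAt (by simp)) (hψ.2 t ht)
    simp only [SecondOrderOn, Set.forall_mem_image]
    exact forall₂_congr fun t ht ↦ by rw [h t ht, eq_comm]
  have integrable_project :
      IsIntegrableAlongOn (velModel k 𝓘(ℝ, E)) (covelModel k 𝓘(ℝ, E)) I₁ K jS →
        IsIntegrableOn I₀ I₂ X₀ jP := by
    intro hint p
    obtain ⟨s, rfl⟩ := hFLSsurj p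
    obtain ⟨U, hU, h0, ψS, rfl, hψS, hψ⟩ := hint s
    exact ⟨U, hU, h0, FLS ∘ ψS, rfl, project U ψS hU hψS hψ⟩
  have integrable_of_secondOrder (h2 : SecondOrderOn K (Set.range jS))
      (hint : IsIntegrableOn I₀ I₂ X₀ jP) :
      IsIntegrableAlongOn (velModel k 𝓘(ℝ, E)) (covelModel k 𝓘(ℝ, E)) I₁ K jS := by
    -- The second-order condition recovers `jS s` from `X₀` at `FLS s`.
    have hrec : ∀ s, jS s = mapVel (covelModel k 𝓘(ℝ, E)) 𝓘(ℝ, E)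
        (fun β : Covel k 𝓘(ℝ, E) Q ↦ β.proj)
        (mapVel I₀ (covelModel k 𝓘(ℝ, E)) j₀ (X₀.toMap (jP (FLS s)))) := fun s ↦ by
      rw [hFLS, hrel, h2 _ (Set.mem_range_self s)]
    have hFLSinj : Function.Injective FLS := fun s s' h ↦
      hjS.isEmbedding.injective (by rw [hrec s, hrec s', h])
    intro s
    obtain ⟨U, hU, h0, ψP, hs, hψP, hψ⟩ := hint (FLS s)
    have hg := Function.rightInverse_surjInv hFLSsurj
    refine ⟨U, hU, h0, Function.surjInv hFLSsurj ∘ ψP, hFLSinj ?_, ?_⟩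
    · rw [Function.comp_apply, hg, hs]
    have hψS : ContMDiffOn 𝓘(ℝ, Fin k → ℝ) I₁ ∞ (Function.surjInv hFLSsurj ∘ ψP) U := by
      intro t ht
      have hjPψ : ∀ t ∈ U, MDifferentiableAt 𝓘(ℝ, Fin k → ℝ) I₀ (jP ∘ ψP) t := fun t ht ↦
        (hψ.1.contMDiffAt (hU.mem_nhds ht)).mdifferentiableAt (by simp)
      have heqU : ∀ t ∈ U, (jS ∘ Function.surjInv hFLSsurj ∘ ψP) t =
          prolong 𝓘(ℝ, E) (fun t' ↦ (j₀ (jP (ψP t'))).proj) t := by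
        intro t ht
        simp only [Function.comp_apply]
        rw [hrec, hg]
        have := hψ.2 t ht
        simp only [Function.comp_apply] at this
        rw [← this, mapVel_prolong (hj₀d _) (hjPψ t ht),
          mapVel_prolong (mdifferentiable_covel_proj _) ((hj₀d _).comp _ (hjPψ t ht))]
        rfl
      refine (hjS.contMDiffAt_of_comp ?_).contMDiffWithinAt
      refine ContMDiffAt.congr_of_eventuallyEq ?_
        (Filter.eventuallyEq_of_mem (hU.mem_nhds ht) heqU)
      refine ContMDiffAt.prolong ?_
      exact ((Bundle.contMDiff_proj (CovelFiber k 𝓘(ℝ, E) Q)).comp hj₀.contMDiff).contMDiffAt.comp t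
        (hψ.1.contMDiffAt (hU.mem_nhds ht))
    exact ⟨hψS, lift U ψP _ hU hψ hψS fun t _ ↦ (hg (ψP t)).symm⟩
  have integrable_of_submersion (hsub : Manifold.IsSubmersion I₁ I₂ ∞ FLS)
      (hint : IsIntegrableOn I₀ I₂ X₀ jP) :
      IsIntegrableAlongOn (velModel k 𝓘(ℝ, E)) (covelModel k 𝓘(ℝ, E)) I₁ K jS := by
    intro s
    obtain ⟨U, hU, h0, ψP, hs, hψP, hψ⟩ := hint (FLS s)
    obtain ⟨σ, hσs, hσ⟩ := (hsub.isSubmersionAt s).exists_local_section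
    -- `σ` is a smooth section only near `FLS s`, so the domain has to shrink.
    have hc : ContinuousAt ψP 0 := (hψP.contMDiffAt (hU.mem_nhds h0)).continuousAt
    rw [← hs] at hσ
    obtain ⟨V, hVsub, hV, h0V⟩ := eventually_nhds_iff.1 (hc.eventually hσ)
    have hψS : ContMDiffOn 𝓘(ℝ, Fin k → ℝ) I₁ ∞ (σ ∘ ψP) (U ∩ V) := fun t ht ↦
      ((hVsub t ht.2).1.comp t (hψP.contMDiffAt (hU.mem_nhds ht.1))).contMDiffWithinAt
    refine ⟨U ∩ V, hU.inter hV, ⟨h0, h0V⟩, σ ∘ ψP, ?_, hψS, lift (U ∩ V) ψP _ (hU.inter hV)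
      ⟨hψ.1.mono Set.inter_subset_left, fun t ht ↦ hψ.2 t ht.1⟩ hψS
      fun t ht ↦ (hVsub t ht.2).2.symm⟩
    rw [Function.comp_apply, hs, hσs]
  refine ⟨integrable_project, fun h ↦ ⟨integrable_project, fun hint ↦ ?_⟩, project, ?_, ?_, ?_⟩
  · exact h.elim (integrable_of_secondOrder · hint) (integrable_of_submersion · hint)
  · intro U ψP ψS hU _ hψ hψS hlift
    have hsec := lift U ψP ψS hU hψ hψS hlift
    exact ⟨hsec, holonomic U _ hU hsec⟩
  · intro hint
    refine ⟨fun hall ↦ ?_, fun h2 U ψP ψS hU _ hψ hψS hlift ↦ ?_⟩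
    · rintro _ ⟨s, rfl⟩
      -- The section of `K` through `s` is one of the lifts.
      obtain ⟨U, hU, h0, ψS, rfl, hψS, hψ⟩ := hint s
      obtain ⟨hψP, hψ₀⟩ := project U ψS hU hψS hψ
      exact (holonomic U _ hU hψ).1 (hall U _ ψS hU hψP hψ₀ hψS fun _ _ ↦ rfl) _ ⟨0, h0, rfl⟩
    · refine (holonomic U _ hU (lift U ψP ψS hU hψ hψS hlift)).2 ?_
      rintro _ ⟨t, _, rfl⟩
      exact h2 _ ⟨ψS t, rfl⟩
  · refine fun h2 ↦ ⟨hK, heq.elim id fun hH ↦ ?_, h2⟩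
    rw [hP] at hH
    refine fieldEquation_of_hamiltonEquation hreg.factor hj₀d hFL₀d ?_ hH
    rintro _ ⟨s, rfl⟩
    exact hrel s
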